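/- Let $\widehat G$ be a finite group, let $\pi:\widehat G\to C_2=\{1,-1\}$ be a surjective homomorphism, and let $G=\ker\pi$. An A-representation (antilinear representation) is a complex vector space $W$ with an action of $\widehat G$ by real-linear maps such that elements of $G$ act $\mathbb C$-linearly and elements of $\widehat G\setminus G$ act $\mathbb C$-antilinearly. It is irreducible if $W\neq 0$ and its only $\widehat G$-stable complex subspaces are $0$ and $W$ (such a $W$ is automatically finite-dimensional). An isomorphism of A-representations is a $\mathbb C$-linear $\widehat G$-equivariant bijection. The A-character of a finite-dimensional $W$ is the function $\chi_W:G\to\mathbb C$ sending $g$ to the trace of $g$ on $W$. The Real conjugacy classes of $G$ are the orbits of the action of $\widehat G$ on $G$ given by $z\cdot g=z\,g^{\pi(z)}z^{-1}$, and a Real class function is a function $G\to\mathbb C$ that is constant on Real conjugacy classes. Then the number of isomorphism classes of irreducible A-representations equals the number of Real conjugacy classes of $G$ (in particular it is finite). Moreover, the irreducible A-characters $\chi_W$, indexed by the isomorphism classes of irreducible A-representations $W$, form a basis of the $\mathbb C$-vector space of Real class functions on $G$. -/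

import Mathlib

universe u v

noncomputable section

/-- The action of `C₂ = {1, -1}` on `ℂ`: `1` acts as the identity and `-1` as complex
conjugation. -/
def signConj (ε : ℤˣ) (c : ℂ) : ℂ :=
  if ε = 1 then c else (starRingEnd ℂ) c

section RealConjugation

variable {Ghat : Type u} [Group Ghat] (π : Ghat →* ℤˣ)

/-- The element `z g^{π(z)} z⁻¹` of the ungraded subgroup `G = ker π`. -/
def realConj (z : Ghat) (g : π.ker) : π.ker :=
  ⟨z * (g : Ghat) ^ ((π z : ℤˣ) : ℤ) * z⁻¹,
    (MonoidHom.normal_ker π).conj_mem _ (Subgroup.zpow_mem _ g.2 _) z⟩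

/-- Real conjugation, as an action of `Ĝ` on `G = ker π`. -/
abbrev realConjAction : MulAction Ghat π.ker where
  smul := realConj π
  one_smul g := by
    apply Subtype.ext
    change (1 : Ghat) * (g : Ghat) ^ ((π 1 : ℤˣ) : ℤ) * 1⁻¹ = g
    simp
  mul_smul y z g := by
    apply Subtype.ext
    change (y * z) * (g : Ghat) ^ ((π (y * z) : ℤˣ) : ℤ) * (y * z)⁻¹ =
      y * (z * (g : Ghat) ^ ((π z : ℤˣ) : ℤ) * z⁻¹) ^ ((π y : ℤˣ) : ℤ) * y⁻¹
    rw [conj_zpow, ← zpow_mul, map_mul, Units.val_mul, mul_comm ((π y : ℤˣ) : ℤ)]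
    group

/-- The set of Real conjugacy classes of `G`: the orbits of Real conjugation. -/
def RealConjClasses : Type u :=
  @MulAction.orbitRel.Quotient Ghat π.ker _ (realConjAction π)

/-- The complex vector space of Real class functions: the functions `G → ℂ` that are constant
on Real conjugacy classes. -/
def realClassFunctions : Submodule ℂ (π.ker → ℂ) where
  carrier := {ψ | ∀ (z : Ghat) (g : π.ker), ψ (realConj π z g) = ψ g}
  zero_mem' _ _ := rfl
  add_mem' ha hb z g := by simp only [Pi.add_apply, ha z g, hb z g]
  smul_mem' c _ ha z g := by simp only [Pi.smul_apply, ha z g]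

end RealConjugation

/-- An antilinear representation (A-representation) of the `C₂`-graded group `π : Ĝ → C₂`:
a complex vector space on which `Ĝ` acts, even elements acting `ℂ`-linearly and odd elements
`ℂ`-antilinearly. -/
structure ARep {Ghat : Type u} [Group Ghat] (π : Ghat →* ℤˣ) where
  V : Type v
  [addCommGroup : AddCommGroup V]
  [module : Module ℂ V]
  ρ : Ghat →* (V →ₗ[ℝ] V)
  map_smul' : ∀ (z : Ghat) (c : ℂ) (x : V), ρ z (c • x) = signConj (π z) c • ρ z x

attribute [instance] ARep.addCommGroup ARep.module

namespace ARep

variable {Ghat : Type u} [Group Ghat] {π : Ghat →* ℤˣ}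

/-- The `ℂ`-linear operator by which an even element acts. -/
def evenOp (W : ARep.{u, v} π) (g : π.ker) : W.V →ₗ[ℂ] W.V where
  toFun := W.ρ g
  map_add' := (W.ρ g).map_add
  map_smul' c x := by
    have hg : π (g : Ghat) = 1 := g.2
    simp [W.map_smul', signConj, hg]

/-- The A-character: the character of the restriction to `G = ker π`. -/
def character (W : ARep.{u, v} π) (g : π.ker) : ℂ :=
  LinearMap.trace ℂ W.V (W.evenOp g)

/-- `W` is irreducible: it is non-zero and has no `Ĝ`-stable complex subspaces other than
`0` and `W`. -/
def IsIrreducible (W : ARep.{u, v} π) : Prop :=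
  Nontrivial W.V ∧
    ∀ U : Submodule ℂ W.V, (∀ (z : Ghat), ∀ x ∈ U, W.ρ z x ∈ U) → U = ⊥ ∨ U = ⊤

/-- Isomorphism of A-representations: a `ℂ`-linear, `Ĝ`-equivariant bijection. -/
def IsIso (W₁ W₂ : ARep.{u, v} π) : Prop :=
  ∃ e : W₁.V ≃ₗ[ℂ] W₂.V, ∀ (z : Ghat) (x : W₁.V), e (W₁.ρ z x) = W₂.ρ z (e x)

variable (π) in
/-- The irreducible A-representations, up to isomorphism, as a setoid. -/
def irrSetoid : Setoid {W : ARep.{u, v} π // W.IsIrreducible} where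
  r W₁ W₂ := IsIso W₁.1 W₂.1
  iseqv :=
    { refl := fun _ => ⟨LinearEquiv.refl ℂ _, fun _ _ => rfl⟩
      symm := fun ⟨e, he⟩ => ⟨e.symm, fun z x => by
        rw [LinearEquiv.symm_apply_eq, he, LinearEquiv.apply_symm_apply]⟩
      trans := fun ⟨e, he⟩ ⟨f, hf⟩ => ⟨e.trans f, fun z x => by
        simp only [LinearEquiv.trans_apply, he, hf]⟩ }

variable (π) in
/-- The set of isomorphism classes of irreducible A-representations. -/
def IrrClasses : Type (max u (v + 1)) :=
  Quotient (irrSetoid.{u, v} π)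

/-- The isomorphism class of an irreducible A-representation. -/
def irrClass (W : ARep.{u, v} π) (hW : W.IsIrreducible) : IrrClasses.{u, v} π :=
  Quotient.mk (irrSetoid.{u, v} π) ⟨W, hW⟩

end ARep

end

/-!
Two irreducible A-representations `W₁`, `W₂` satisfy
`|G|⁻¹ ∑ χ₂(g) χ₁(g⁻¹) = dim Hom_G(W₁, W₂)`. The group `Ĝ` acts on `Hom_G(W₁, W₂)` by conjugation,
odd elements antilinearly, so a non-zero `G`-map `f` yields a non-zero `Ĝ`-map as the average of `f`
or of `i f`; by Schur's lemma `W₁` and `W₂` are then isomorphic (`ARep.isIso_of_even_equivariant`).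
Hence the irreducible A-characters are orthogonal and linearly independent
(`ARep.linearIndependent_classCharacter`). They are Real class functions, because an odd element
and inversion of `g` each conjugate the trace (`ARep.character_mem`).

For the spanning property, let `ψ` be a Real class function with `∑ ψ(g) χ_W(g) = 0` for all
irreducible `W`. Since `ψ ↦ (g ↦ conj ψ(g⁻¹))` preserves these conditions, one may assume that it
fixes `ψ`. Then `∑ ψ(g) ρ(g)` commutes with all of `Ĝ`, and on the regular A-representation
`Ĝ → ℂ` it is a Hermitian matrix. If `ψ ≠ 0`, this matrix has an eigenvalue `t ≠ 0`; as `t` is real,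
its eigenspace is stable under odd elements as well and contains an irreducible `W`, on which
`∑ ψ(g) χ_W(g) = t dim W ≠ 0`. So `ψ = 0` (`ARep.eq_zero_of_sum_mul_character`), and the
dimension of the space of Real class functions, which is the number of Real conjugacy classes, is at
most the number of irreducible A-representations.
-/

noncomputable section

open Module

/-! ### Traces of operators and of their conjugates -/

/-- If an invertible antilinear map intertwines `A` and `B`, then `B` is, in coordinates, similar to
the complex conjugate of `A`. -/
theorem LinearMap.trace_eq_conj_of_antilinear {V : Type*} [AddCommGroup V] [Module ℂ V]
    [FiniteDimensional ℂ V] (A B : V →ₗ[ℂ] V) (f f' : V →ₛₗ[starRingEnd ℂ] V)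
    (hf : ∀ x, f (f' x) = x) (h : ∀ x, B (f x) = f (A x)) :
    LinearMap.trace ℂ V B = starRingEnd ℂ (LinearMap.trace ℂ V A) := by
  classical
  set b := Module.finBasis ℂ V
  have hexp (k : V →ₛₗ[starRingEnd ℂ] V) (x : V) (i) :
      b.repr (k x) i = ∑ j, b.repr (k (b j)) i * starRingEnd ℂ (b.repr x j) := by
    have hx := congrArg (fun y => b.repr (k y) i) (b.sum_repr x)
    simp only [map_sum, map_smulₛₗ, Finsupp.coe_finsetSum, Finset.sum_apply, Finsupp.smul_apply,
      RingHom.id_apply, smul_eq_mul] at hx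
    rw [← hx]
    exact Finset.sum_congr rfl fun j _ => mul_comm _ _
  -- `Z` is the matrix of `f`, and the conjugates in `Z'` make `Z * Z'` the matrix of `f ∘ f'`.
  let Z : Matrix (Fin (finrank ℂ V)) (Fin (finrank ℂ V)) ℂ :=
    Matrix.of fun i j => b.repr (f (b j)) i
  let Z' : Matrix (Fin (finrank ℂ V)) (Fin (finrank ℂ V)) ℂ :=
    Matrix.of fun i j => starRingEnd ℂ (b.repr (f' (b j)) i)
  have hZ : Z * Z' = 1 := by
    ext i j
    have := hexp f (f' (b j)) i
    rw [hf] at this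
    simp only [Matrix.mul_apply, Z, Z', Matrix.of_apply, ← this, Matrix.one_apply,
      Basis.repr_self, Finsupp.single_apply, eq_comm]
  have hB : LinearMap.toMatrix b b B * Z = Z * (LinearMap.toMatrix b b A).map (starRingEnd ℂ) := by
    ext i j
    have h1 : b.repr (B (f (b j))) i
        = (LinearMap.toMatrix b b B).mulVec (b.repr (f (b j))) i := by
      rw [LinearMap.toMatrix_mulVec_repr]
    have h2 := hexp f (A (b j)) i
    rw [← h, h1] at h2
    simpa [Matrix.mul_apply, Z, Matrix.mulVec, dotProduct, LinearMap.toMatrix_apply] using h2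
  rw [LinearMap.trace_eq_matrix_trace ℂ b, LinearMap.trace_eq_matrix_trace ℂ b,
    ← Matrix.mul_one (LinearMap.toMatrix b b B), ← hZ, ← Matrix.mul_assoc, hB, Matrix.trace_mul_comm,
    ← Matrix.mul_assoc, mul_eq_one_comm.mp hZ, Matrix.one_mul]
  simp [Matrix.trace, map_sum]

open scoped ComplexOrder in
/-- The character of a finite group satisfies `χ(g⁻¹) = conj χ(g)`: averaging gives a positive
definite form `P` preserved by the action, and `P` conjugates `ρ(g)` into `ρ(g⁻¹)ᴴ`. -/
theorem Representation.character_inv_eq_conj {G V : Type*} [Group G] [Finite G] [AddCommGroup V]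
    [Module ℂ V] [FiniteDimensional ℂ V] (ρ : Representation ℂ G V) (h : G) :
    ρ.character h⁻¹ = starRingEnd ℂ (ρ.character h) := by
  classical
  have := Fintype.ofFinite G
  set b := Module.finBasis ℂ V
  let M : G → Matrix (Fin (finrank ℂ V)) (Fin (finrank ℂ V)) ℂ := fun g =>
    LinearMap.toMatrix b b (ρ g)
  have hM (g k : G) : M (g * k) = M g * M k := by
    simp only [M, map_mul, LinearMap.toMatrix_mul]
  let P := ∑ g, (M g).conjTranspose * M g
  have hP : P.PosDef := by
    rw [show P = (M 1).conjTranspose * M 1 + ∑ g ∈ Finset.univ.erase 1, (M g).conjTranspose * M g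
      from (Finset.add_sum_erase _ _ (Finset.mem_univ 1)).symm]
    refine Matrix.PosDef.add_posSemidef ?_
      (Matrix.posSemidef_sum _ fun g _ => Matrix.posSemidef_conjTranspose_mul_self _)
    have h1 : M 1 = 1 := by simp [M]
    rw [h1, Matrix.conjTranspose_one, Matrix.one_mul]
    exact Matrix.PosDef.one
  have hinv : (M h⁻¹).conjTranspose * P = P * M h := by
    simp only [P, Finset.mul_sum, Finset.sum_mul]
    refine Fintype.sum_equiv (Equiv.mulRight h⁻¹) _ _ fun g => ?_
    simp only [Equiv.coe_mulRight]
    rw [Matrix.mul_assoc, ← hM, inv_mul_cancel_right, hM, Matrix.conjTranspose_mul, Matrix.mul_assoc]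
  have hu := hP.isUnit
  rw [Matrix.isUnit_iff_isUnit_det] at hu
  have key : (M h).trace = star (M h⁻¹).trace := by
    rw [← Matrix.trace_conjTranspose, ← Matrix.mul_one (M h⁻¹).conjTranspose,
      ← Matrix.mul_nonsing_inv P hu, ← Matrix.mul_assoc, hinv, Matrix.trace_mul_comm,
      ← Matrix.mul_assoc, Matrix.nonsing_inv_mul P hu, Matrix.one_mul]
  simp only [Representation.character, LinearMap.trace_eq_matrix_trace ℂ b]
  change (M h⁻¹).trace = starRingEnd ℂ (M h).trace
  rw [key]
  simp

namespace ARep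

variable {Ghat : Type u} [Group Ghat] {π : Ghat →* ℤˣ}

/-! ### Basic constructions -/

/-- The restriction of an A-representation to the even subgroup, as a complex representation. -/
def evenRep (W : ARep.{u, v} π) : Representation ℂ π.ker W.V where
  toFun := W.evenOp
  map_one' := by ext x; simp [evenOp]
  map_mul' g h := by ext x; simp [evenOp]

theorem evenOp_apply (W : ARep.{u, v} π) (g : π.ker) (x : W.V) : W.evenOp g x = W.ρ g x := rfl

@[simp]
theorem ρ_inv_apply (W : ARep.{u, v} π) (z : Ghat) (x : W.V) : W.ρ z⁻¹ (W.ρ z x) = x := by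
  rw [← Module.End.mul_apply, ← map_mul]; simp

@[simp]
theorem ρ_apply_inv (W : ARep.{u, v} π) (z : Ghat) (x : W.V) : W.ρ z (W.ρ z⁻¹ x) = x := by
  rw [← Module.End.mul_apply, ← map_mul]; simp

theorem ρ_mul_apply (W : ARep.{u, v} π) (y z : Ghat) (x : W.V) :
    W.ρ (y * z) x = W.ρ y (W.ρ z x) := by
  rw [map_mul]; rfl

theorem _root_.signConj_of_odd {ε : ℤˣ} (h : ε ≠ 1) (c : ℂ) :
    signConj ε c = starRingEnd ℂ c := if_neg h

@[simp]
theorem _root_.signConj_one (c : ℂ) : signConj 1 c = c := if_pos rfl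

theorem _root_.signConj_mul (ε δ : ℤˣ) (c : ℂ) :
    signConj (ε * δ) c = signConj ε (signConj δ c) := by
  rcases Int.units_eq_one_or ε with rfl | rfl <;> rcases Int.units_eq_one_or δ with rfl | rfl <;>
    simp [signConj]

@[simp]
theorem _root_.signConj_self (ε : ℤˣ) (c : ℂ) : signConj ε (signConj ε c) = c := by
  rw [← signConj_mul]; simp

/-- An odd element acts as an antilinear map. -/
def oddOp (W : ARep.{u, v} π) (z : Ghat) (hz : π z ≠ 1) : W.V →ₛₗ[starRingEnd ℂ] W.V where
  toFun := W.ρ z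
  map_add' := (W.ρ z).map_add
  map_smul' c x := by rw [W.map_smul', signConj_of_odd hz]

/-- A `Ĝ`-stable complex subspace, as an A-representation. -/
def sub (W : ARep.{u, v} π) (U : Submodule ℂ W.V) (hU : ∀ z, ∀ x ∈ U, W.ρ z x ∈ U) :
    ARep.{u, v} π where
  V := U
  ρ :=
    { toFun := fun z =>
        { toFun := fun x => ⟨W.ρ z x, hU z x x.2⟩
          map_add' := fun x y => Subtype.ext (by simp)
          map_smul' := fun c x => Subtype.ext (by simp) }
      map_one' := by ext x; simp
      map_mul' := fun y z => by ext x; simp }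
  map_smul' z c x := Subtype.ext (W.map_smul' z c x)

/-- Transport of an A-representation along a linear isomorphism, possibly to another universe. -/
def transport {V' : Type*} [AddCommGroup V'] [Module ℂ V'] (W : ARep.{u, v} π)
    (e : W.V ≃ₗ[ℂ] V') : ARep π where
  V := V'
  ρ :=
    { toFun := fun z =>
        { toFun := fun x => e (W.ρ z (e.symm x))
          map_add' := fun x y => by simp
          map_smul' := fun c x => by
            rw [← Complex.coe_smul, ← Complex.coe_smul, map_smul, Complex.coe_smul, map_smul,
              ← Complex.coe_smul, map_smul]
            rfl }
      map_one' := by ext x; simp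
      map_mul' := fun y z => by ext x; simp }
  map_smul' z c x := by simp [W.map_smul']

theorem transport_character {V' : Type*} [AddCommGroup V'] [Module ℂ V'] (W : ARep.{u, v} π)
    (e : W.V ≃ₗ[ℂ] V') : (W.transport e).character = W.character := by
  ext g
  exact LinearMap.trace_conj' (W.evenOp g) e

theorem IsIrreducible.transport {V' : Type*} [AddCommGroup V'] [Module ℂ V'] {W : ARep.{u, v} π}
    (hW : W.IsIrreducible) (e : W.V ≃ₗ[ℂ] V') : (W.transport e).IsIrreducible := by
  have := hW.1
  refine ⟨e.symm.toEquiv.nontrivial, fun U hU => ?_⟩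
  have key := hW.2 (Submodule.comap e.toLinearMap U) fun z x hx => by
    have := hU z (e x) hx
    change e (W.ρ z (e.symm (e x))) ∈ U at this
    rwa [e.symm_apply_apply] at this
  have hinj := Submodule.comap_injective_of_surjective (f := e.toLinearMap) e.surjective
  rcases key with h | h
  · left; apply hinj; rw [h]; exact (LinearMap.ker_eq_bot.mpr e.injective).symm
  · right; apply hinj; rw [h]; rfl

/-- An irreducible A-representation is spanned by the orbit of any non-zero vector. -/
theorem IsIrreducible.finiteDimensional [Finite Ghat] {W : ARep.{u, v} π} (hW : W.IsIrreducible) :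
    FiniteDimensional ℂ W.V := by
  have := hW.1
  obtain ⟨x, hx⟩ := exists_ne (0 : W.V)
  have hmem : x ∈ Submodule.span ℂ (Set.range fun z => W.ρ z x) :=
    Submodule.subset_span ⟨1, by simp⟩
  rcases hW.2 (Submodule.span ℂ (Set.range fun z => W.ρ z x)) (fun z y hy => by
    induction hy using Submodule.span_induction with
    | mem y hy =>
      obtain ⟨w, rfl⟩ := hy
      exact Submodule.subset_span ⟨z * w, W.ρ_mul_apply z w x⟩
    | zero => simp
    | add a b _ _ ha hb => rw [map_add]; exact add_mem ha hb
    | smul c a _ ha => rw [W.map_smul']; exact Submodule.smul_mem _ _ ha) with h | h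
  · rw [h] at hmem
    exact absurd (by simpa using hmem) hx
  · exact ⟨h ▸ Submodule.fg_span (Set.finite_range _)⟩

/-- A minimal non-zero stable subspace is irreducible. -/
theorem exists_irreducible_sub (W : ARep.{u, v} π) [FiniteDimensional ℂ W.V] (U : Submodule ℂ W.V)
    (hU : ∀ z, ∀ x ∈ U, W.ρ z x ∈ U) (hne : U ≠ ⊥) :
    ∃ (U' : Submodule ℂ W.V) (hU' : ∀ z, ∀ x ∈ U', W.ρ z x ∈ U'),
      U' ≤ U ∧ (W.sub U' hU').IsIrreducible := by
  obtain ⟨U', ⟨h1, h2, h3⟩, hmin⟩ := exists_minimal_of_wellFoundedLT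
    (fun U' : Submodule ℂ W.V => (∀ z, ∀ x ∈ U', W.ρ z x ∈ U') ∧ U' ≤ U ∧ U' ≠ ⊥)
    ⟨U, hU, le_rfl, hne⟩
  refine ⟨U', h1, h2, Submodule.nontrivial_iff_ne_bot.mpr h3, fun T hT => ?_⟩
  change Submodule ℂ U' at T
  by_cases hbot : T = ⊥
  · exact Or.inl hbot
  right
  have hle : T.map U'.subtype ≤ U' := Submodule.map_subtype_le U' T
  have := hmin (y := T.map U'.subtype) ⟨?_, hle.trans h2, ?_⟩ hle
  · exact eq_top_iff.mpr fun x _ => by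
      obtain ⟨y, hy, hyx⟩ := this x.2
      exact (Subtype.ext hyx : y = x) ▸ hy
  · rintro z _ ⟨x, hx, rfl⟩
    exact ⟨_, hT z x hx, rfl⟩
  · rwa [Ne, ← Submodule.map_bot U'.subtype,
      (Submodule.map_injective_of_injective U'.injective_subtype).eq_iff]

theorem IsIso.character_eq {W₁ W₂ : ARep.{u, v} π} (h : IsIso W₁ W₂) :
    W₁.character = W₂.character := by
  obtain ⟨e, he⟩ := h
  ext g
  rw [character, ← LinearMap.trace_conj' (W₁.evenOp g) e]
  congr 1
  ext x
  simp [LinearEquiv.conj_apply, evenOp_apply, he]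

/-! ### Characters are Real class functions -/

theorem character_inv [Finite Ghat] (W : ARep.{u, v} π) [FiniteDimensional ℂ W.V] (g : π.ker) :
    W.character g⁻¹ = starRingEnd ℂ (W.character g) :=
  W.evenRep.character_inv_eq_conj g

/-- An odd `z` conjugates the trace of `g`, and so does inversion of `g`; together the two
conjugations cancel. -/
theorem character_mem [Finite Ghat] (W : ARep.{u, v} π) [FiniteDimensional ℂ W.V] :
    W.character ∈ realClassFunctions π := by
  intro z g
  by_cases hz : π z = 1
  · have h : realConj π z g = (⟨z, hz⟩ : π.ker) * g * (⟨z, hz⟩ : π.ker)⁻¹ := by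
      apply Subtype.ext
      simp [realConj, hz]
    rw [h]
    exact W.evenRep.char_conj g _
  · have hz' : π z = -1 := (Int.units_eq_one_or _).resolve_left hz
    have hzi : π z⁻¹ ≠ 1 := by simpa using hz
    rw [character, LinearMap.trace_eq_conj_of_antilinear (W.evenOp g⁻¹) _ (W.oddOp z hz)
      (W.oddOp z⁻¹ hzi) (W.ρ_apply_inv z)]
    · change starRingEnd ℂ (W.character g⁻¹) = _
      rw [character_inv, Complex.conj_conj]
    · intro x
      change W.ρ (realConj π z g : Ghat) (W.ρ z x) = W.ρ z (W.ρ (g⁻¹ : π.ker) x)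
      simp only [← ρ_mul_apply]
      simp [realConj, hz']

/-! ### Orthogonality -/

/-- The average `∑ z, z f z⁻¹` of a complex-linear map over the whole group `Ĝ`; conjugation by an
odd element applies the antilinear action twice, so the result is again complex-linear. -/
def averageHom [Fintype Ghat] (W₁ W₂ : ARep.{u, v} π) (f : W₁.V →ₗ[ℂ] W₂.V) :
    W₁.V →ₗ[ℂ] W₂.V where
  toFun x := ∑ z, W₂.ρ z (f (W₁.ρ z⁻¹ x))
  map_add' x y := by simp [Finset.sum_add_distrib]
  map_smul' c x := by
    rw [RingHom.id_apply, Finset.smul_sum]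
    refine Finset.sum_congr rfl fun z _ => ?_
    rw [W₁.map_smul', map_smul, W₂.map_smul', ← signConj_mul, ← map_mul]
    simp

theorem averageHom_apply [Fintype Ghat] (W₁ W₂ : ARep.{u, v} π) (f : W₁.V →ₗ[ℂ] W₂.V) (x : W₁.V) :
    averageHom W₁ W₂ f x = ∑ z, W₂.ρ z (f (W₁.ρ z⁻¹ x)) := rfl

theorem averageHom_equivariant [Fintype Ghat] (W₁ W₂ : ARep.{u, v} π) (f : W₁.V →ₗ[ℂ] W₂.V)
    (y : Ghat) (x : W₁.V) : averageHom W₁ W₂ f (W₁.ρ y x) = W₂.ρ y (averageHom W₁ W₂ f x) := by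
  simp only [averageHom_apply, map_sum]
  refine Fintype.sum_equiv (Equiv.mulLeft y⁻¹) _ _ fun z => ?_
  simp only [← ρ_mul_apply, Equiv.coe_mulLeft, mul_inv_rev, inv_inv, mul_inv_cancel_left]

/-- Schur's lemma. -/
theorem isIso_of_equivariant {W₁ W₂ : ARep.{u, v} π} (h₁ : W₁.IsIrreducible)
    (h₂ : W₂.IsIrreducible) (f : W₁.V →ₗ[ℂ] W₂.V) (hf : ∀ z x, f (W₁.ρ z x) = W₂.ρ z (f x))
    (hne : f ≠ 0) : IsIso W₁ W₂ := by
  have hker : LinearMap.ker f = ⊥ := by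
    refine (h₁.2 (LinearMap.ker f) fun z x hx => ?_).resolve_right
      fun h => hne (LinearMap.ker_eq_top.mp h)
    rw [LinearMap.mem_ker] at hx ⊢
    rw [hf, hx, map_zero]
  have hrange : LinearMap.range f = ⊤ := by
    refine (h₂.2 (LinearMap.range f) ?_).resolve_left
      fun h => hne (LinearMap.range_eq_bot.mp h)
    rintro z _ ⟨x, rfl⟩
    exact ⟨W₁.ρ z x, hf z x⟩
  exact ⟨LinearEquiv.ofBijective f ⟨LinearMap.ker_eq_bot.mp hker, LinearMap.range_eq_top.mp hrange⟩,
    hf⟩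

/-- A non-zero map that is only `G`-equivariant already forces an isomorphism of A-representations:
the `Ĝ`-averages of `f` and `i f` cannot both vanish. -/
theorem isIso_of_even_equivariant [Finite Ghat] {W₁ W₂ : ARep.{u, v} π} (h₁ : W₁.IsIrreducible)
    (h₂ : W₂.IsIrreducible) (f : W₁.V →ₗ[ℂ] W₂.V)
    (hf : ∀ (g : π.ker) x, f (W₁.ρ g x) = W₂.ρ g (f x)) (hne : f ≠ 0) : IsIso W₁ W₂ := by
  classical
  have := Fintype.ofFinite Ghat
  by_contra hiso
  have hzero (k : W₁.V →ₗ[ℂ] W₂.V) : averageHom W₁ W₂ k = 0 := by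
    by_contra hk
    exact hiso (isIso_of_equivariant h₁ h₂ _ (averageHom_equivariant W₁ W₂ k) hk)
  apply hne
  ext x
  -- In `A(f) - i A(i f)` the terms of odd `z` cancel, and those of even `z` are `2 f`.
  have key : averageHom W₁ W₂ f x - Complex.I • averageHom W₁ W₂ (Complex.I • f) x =
      ∑ z : Ghat, if π z = 1 then (2 : ℂ) • f x else 0 := by
    rw [averageHom_apply, averageHom_apply, Finset.smul_sum, ← Finset.sum_sub_distrib]
    refine Finset.sum_congr rfl fun z _ => ?_
    rw [LinearMap.smul_apply, W₂.map_smul', smul_smul]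
    split_ifs with hz
    · have hfz : W₂.ρ z (f (W₁.ρ z⁻¹ x)) = f x := by
        rw [← hf ⟨z, hz⟩]
        simp
      rw [hz, hfz, signConj_one, Complex.I_mul_I, neg_smul, one_smul, sub_neg_eq_add, two_smul]
    · rw [signConj_of_odd hz]
      simp
  rw [hzero, hzero, ← Finset.sum_filter, Finset.sum_const] at key
  have hcard : (Finset.univ.filter fun z : Ghat => π z = 1).card ≠ 0 :=
    Finset.card_ne_zero_of_mem (a := 1) (by simp)
  simpa [← Nat.cast_smul_eq_nsmul ℂ, hcard, -nsmul_eq_smul] using key.symm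

theorem sum_character_mul_character_inv_of_not_isIso [Finite Ghat] [Fintype π.ker]
    {W₁ W₂ : ARep.{u, v} π} (h₁ : W₁.IsIrreducible) (h₂ : W₂.IsIrreducible)
    (h : ¬ IsIso W₁ W₂) : ∑ g, W₂.character g * W₁.character g⁻¹ = 0 := by
  have := h₁.finiteDimensional
  have := h₂.finiteDimensional
  have hc : (Nat.card π.ker : ℂ) ≠ 0 := by exact_mod_cast Nat.card_pos.ne'
  have : Invertible (Nat.card π.ker : ℂ) := invertibleOfNonzero hc
  have key := Representation.card_inv_mul_sum_char_mul_char_eq_finrank W₁.evenRep W₂.evenRep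
  have : Subsingleton (Representation.IntertwiningMap W₁.evenRep W₂.evenRep) := by
    refine subsingleton_of_forall_eq 0 fun f => ?_
    by_contra hf
    refine h (isIso_of_even_equivariant h₁ h₂ f.toLinearMap (fun g x => ?_) fun h0 => hf ?_)
    · exact LinearMap.congr_fun (f.isIntertwining' g) x
    · exact Representation.IntertwiningMap.ext h0
  rw [finrank_zero_of_subsingleton, Nat.cast_zero] at key
  exact (mul_eq_zero.mp key).resolve_left (inv_ne_zero hc)

theorem sum_character_mul_character_inv_ne_zero [Finite Ghat] [Fintype π.ker]
    {W : ARep.{u, v} π} (hW : W.IsIrreducible) :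
    ∑ g, W.character g * W.character g⁻¹ ≠ 0 := by
  have := hW.finiteDimensional
  have := hW.1
  -- Every term is `|χ(g)|² ≥ 0`, and the term at `g = 1` is positive.
  have key : ∑ g, W.character g * W.character g⁻¹ =
      ((∑ g, Complex.normSq (W.character g) : ℝ) : ℂ) := by
    rw [Complex.ofReal_sum]
    exact Finset.sum_congr rfl fun g _ => by rw [character_inv, Complex.mul_conj]
  rw [key, Complex.ofReal_ne_zero]
  refine (Finset.sum_pos' (fun g _ => Complex.normSq_nonneg _) ⟨1, Finset.mem_univ _, ?_⟩).ne'
  have h1 : W.character 1 = finrank ℂ W.V := W.evenRep.char_one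
  rw [Complex.normSq_pos, h1, Nat.cast_ne_zero]
  exact finrank_pos.ne'

/-- The character of a class of irreducible A-representations, as a Real class function. -/
def classCharacter [Finite Ghat] : IrrClasses.{u, v} π → realClassFunctions π :=
  Quotient.lift
    (fun W => ⟨W.1.character, have := W.2.finiteDimensional; W.1.character_mem⟩)
    fun _ _ h => Subtype.ext (IsIso.character_eq h)

theorem classCharacter_irrClass [Finite Ghat] (W : ARep.{u, v} π) (hW : W.IsIrreducible) :
    (classCharacter (irrClass W hW) : π.ker → ℂ) = W.character := rfl

theorem linearIndependent_classCharacter [Finite Ghat] :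
    LinearIndependent ℂ (classCharacter : IrrClasses.{u, v} π → realClassFunctions π) := by
  have := Fintype.ofFinite π.ker
  let B : LinearMap.BilinForm ℂ (realClassFunctions π) :=
    LinearMap.mk₂ ℂ (fun ψ φ => ∑ g, ψ.1 g * φ.1 g⁻¹)
      (fun _ _ _ => by simp [add_mul, Finset.sum_add_distrib])
      (fun _ _ _ => by simp [Finset.mul_sum, mul_assoc])
      (fun _ _ _ => by simp [mul_add, Finset.sum_add_distrib])
      (fun _ _ _ => by simp [Finset.mul_sum, mul_left_comm])
  refine LinearMap.BilinForm.linearIndependent_of_iIsOrtho (B := B) ?_ ?_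
  · rw [LinearMap.BilinForm.iIsOrtho_def]
    intro i j
    induction i using Quotient.inductionOn with | _ W₂
    induction j using Quotient.inductionOn with | _ W₁
    intro hne
    exact sum_character_mul_character_inv_of_not_isIso W₁.2 W₂.2
      fun h => hne (Quotient.sound h).symm
  · intro i
    induction i using Quotient.inductionOn with | _ W
    exact sum_character_mul_character_inv_ne_zero W.2

/-! ### Operators attached to Real class functions -/

/-- The operator `∑ g, ψ(g) ρ(g)` attached to a function `ψ` on `G`. -/
def sumOp [Fintype π.ker] (W : ARep.{u, v} π) (ψ : π.ker → ℂ) : W.V →ₗ[ℂ] W.V :=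
  ∑ g, ψ g • W.evenOp g

theorem sumOp_apply [Fintype π.ker] (W : ARep.{u, v} π) (ψ : π.ker → ℂ) (x : W.V) :
    W.sumOp ψ x = ∑ g, ψ g • W.ρ g x := by
  simp [sumOp, evenOp_apply]

theorem trace_sumOp [Fintype π.ker] (W : ARep.{u, v} π) (ψ : π.ker → ℂ) :
    LinearMap.trace ℂ W.V (W.sumOp ψ) = ∑ g, ψ g * W.character g := by
  simp [sumOp, character]

theorem signConj_apply_eq_conj {ψ : π.ker → ℂ} (hψ : ψ ∈ realClassFunctions π)
    (hself : ∀ g, ψ g⁻¹ = starRingEnd ℂ (ψ g)) (z : Ghat) (g : π.ker) :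
    signConj (π z) (ψ g) = ψ (MulAut.conjNormal z g) := by
  by_cases hz : π z = 1
  · rw [hz, signConj_one, ← hψ z g]
    congr 1
    apply Subtype.ext
    simp [realConj, hz]
  · have hz' : π z = -1 := (Int.units_eq_one_or _).resolve_left hz
    rw [signConj_of_odd hz, ← hself, ← hψ z g⁻¹]
    congr 1
    apply Subtype.ext
    simp [realConj, hz']

/-- For a Real class function with `ψ(g⁻¹) = conj ψ(g)`, the operator `∑ g, ψ(g) ρ(g)` commutes
with the even and with the odd elements. -/
theorem sumOp_equivariant [Fintype π.ker] (W : ARep.{u, v} π) {ψ : π.ker → ℂ}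
    (hψ : ψ ∈ realClassFunctions π) (hself : ∀ g, ψ g⁻¹ = starRingEnd ℂ (ψ g)) (z : Ghat)
    (x : W.V) : W.sumOp ψ (W.ρ z x) = W.ρ z (W.sumOp ψ x) := by
  rw [sumOp_apply, sumOp_apply, map_sum]
  refine (Fintype.sum_equiv (MulAut.conjNormal z : π.ker ≃* π.ker).toEquiv _ _ fun g => ?_).symm
  rw [W.map_smul', signConj_apply_eq_conj hψ hself]
  simp only [MulEquiv.toEquiv_eq_coe, EquivLike.coe_coe, MulAut.conjNormal_apply, ← ρ_mul_apply]
  simp only [inv_mul_cancel_right]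

variable (π) in
/-- The regular A-representation: functions `f : Ĝ → ℂ`, with `(z f)(y) = f(z⁻¹ y)` conjugated if
`z` is odd. -/
def regular : ARep.{u, u} π where
  V := Ghat → ℂ
  ρ :=
    { toFun := fun z =>
        { toFun := fun f y => signConj (π z) (f (z⁻¹ * y))
          map_add' := fun f k => by
            ext y
            by_cases hz : π z = 1 <;> simp [signConj, hz]
          map_smul' := fun c f => by
            ext y
            by_cases hz : π z = 1 <;> simp [signConj, hz] }
      map_one' := by ext f y; simp
      map_mul' := fun y z => by
        ext f x
        simp [signConj_mul, mul_assoc] }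
  map_smul' z c f := by
    ext y
    by_cases hz : π z = 1 <;> simp [signConj, hz]

theorem regular_sumOp_apply [Fintype π.ker] (ψ : π.ker → ℂ) (f : Ghat → ℂ) (y : Ghat) :
    ((regular π).sumOp ψ f : Ghat → ℂ) y = ∑ g, ψ g * f ((g : Ghat)⁻¹ * y) := by
  have h : ((regular π).sumOp ψ f : Ghat → ℂ) = ∑ g, ψ g • (regular π).ρ g f :=
    (regular π).sumOp_apply ψ f
  refine (congrFun h y).trans ((Finset.sum_apply y _ _).trans ?_)
  refine Finset.sum_congr rfl fun g _ => ?_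
  change ψ g * signConj (π g) (f ((g : Ghat)⁻¹ * y)) = _
  rw [show π (g : Ghat) = 1 from g.2, signConj_one]

/-- On the regular A-representation, `∑ g, ψ(g) ρ(g)` is a Hermitian matrix when
`ψ(g⁻¹) = conj ψ(g)`, and hence has a non-zero real eigenvalue unless `ψ = 0`. -/
theorem exists_eigenvector_regular_sumOp [Finite Ghat] [Fintype π.ker] {ψ : π.ker → ℂ}
    (hself : ∀ g, ψ g⁻¹ = starRingEnd ℂ (ψ g)) (hne : ψ ≠ 0) :
    ∃ (f : Ghat → ℂ) (t : ℝ), t ≠ 0 ∧ f ≠ 0 ∧ (regular π).sumOp ψ f = (t : ℂ) • f := by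
  classical
  have := Fintype.ofFinite Ghat
  let T : (Ghat → ℂ) →ₗ[ℂ] (Ghat → ℂ) := (regular π).sumOp ψ
  have hentry (y x : Ghat) : LinearMap.toMatrix' T y x =
      ∑ g : π.ker, ψ g * if (g : Ghat)⁻¹ * y = x then 1 else 0 := by
    rw [LinearMap.toMatrix'_apply]
    exact (regular_sumOp_apply ψ _ y).trans (by simp [Pi.single_apply])
  have hherm : (LinearMap.toMatrix' T).IsHermitian := by
    ext y x
    rw [Matrix.conjTranspose_apply, hentry, hentry, star_sum]
    refine Fintype.sum_equiv (Equiv.inv π.ker) _ _ fun g => ?_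
    have hiff : (g : Ghat)⁻¹ * x = y ↔ (g : Ghat) * y = x := by
      rw [inv_mul_eq_iff_eq_mul, eq_comm]
    simp only [Equiv.inv_apply, hself, InvMemClass.coe_inv, inv_inv, hiff]
    split_ifs <;> simp
  obtain ⟨g, hg⟩ := Function.ne_iff.mp hne
  have hT : LinearMap.toMatrix' T ≠ 0 := fun h => hg <| by
    have h1 := hentry g 1
    rw [h] at h1
    simpa [inv_mul_eq_one, Subtype.coe_inj] using h1.symm
  obtain ⟨f, t, ht, hf, hft⟩ := hherm.exists_eigenvector_of_ne_zero hT
  refine ⟨f, t, ht, hf, ?_⟩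
  rw [LinearMap.toMatrix'_mulVec] at hft
  exact hft.trans (by ext; simp)

/-- A conjugation-symmetric Real class function orthogonal to all irreducible characters vanishes:
otherwise its operator acts by a non-zero real scalar on some irreducible A-representation. -/
theorem eq_zero_of_sum_mul_character_of_symmetric [Finite Ghat] [Fintype π.ker] {ψ : π.ker → ℂ}
    (hψ : ψ ∈ realClassFunctions π) (hself : ∀ g, ψ g⁻¹ = starRingEnd ℂ (ψ g))
    (horth : ∀ W : ARep.{u, v} π, W.IsIrreducible → ∑ g, ψ g * W.character g = 0) : ψ = 0 := by
  by_contra hne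
  obtain ⟨f, t, ht, hf, hft⟩ := exists_eigenvector_regular_sumOp hself hne
  have : FiniteDimensional ℂ (regular π).V := inferInstanceAs (FiniteDimensional ℂ (Ghat → ℂ))
  let U : Submodule ℂ (regular π).V := LinearMap.ker ((regular π).sumOp ψ - (t : ℂ) • LinearMap.id)
  have hmem (x) : x ∈ U ↔ (regular π).sumOp ψ x = (t : ℂ) • x := by
    simp [U, sub_eq_zero]
  have hU : ∀ z, ∀ x ∈ U, (regular π).ρ z x ∈ U := fun z x hx => by
    rw [hmem] at hx ⊢
    -- The eigenvalue is real, so that odd elements preserve the eigenspace, too.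
    rw [sumOp_equivariant _ hψ hself, hx, (regular π).map_smul']
    congr 1
    by_cases hz : π z = 1 <;> simp [signConj, hz]
  obtain ⟨U', hU', hle, hirr⟩ := (regular π).exists_irreducible_sub U hU
    (Submodule.ne_bot_iff _ |>.mpr ⟨f, (hmem f).mpr hft, hf⟩)
  let W := (regular π).sub U' hU'
  have := hirr.1
  have : FiniteDimensional ℂ W.V := hirr.finiteDimensional
  have hscalar : W.sumOp ψ = (t : ℂ) • LinearMap.id := by
    ext x
    have hx := (hmem x.1).mp (hle x.2)
    rw [sumOp_apply] at hx
    apply Subtype.ext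
    rw [sumOp_apply]
    refine Eq.trans ?_ hx
    exact map_sum U'.subtype _ _
  have htrace := W.trace_sumOp ψ
  -- A copy of the subrepresentation in the universe of the given A-representations.
  let e : W.V ≃ₗ[ℂ] ULift.{v} (Fin (finrank ℂ W.V) → ℂ) :=
    (finBasis ℂ W.V).equivFun.trans ULift.moduleEquiv.symm
  have hzero := horth (W.transport e) (IsIrreducible.transport hirr e)
  rw [transport_character, ← htrace, hscalar, map_smul, LinearMap.trace_id, smul_eq_mul,
    mul_eq_zero, Complex.ofReal_eq_zero, Nat.cast_eq_zero] at hzero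
  exact hzero.elim ht finrank_pos.ne'

theorem conj_inv_mem_realClassFunctions {ψ : π.ker → ℂ} (hψ : ψ ∈ realClassFunctions π) :
    (fun g => starRingEnd ℂ (ψ g⁻¹)) ∈ realClassFunctions π := fun z g => by
  have h : (realConj π z g)⁻¹ = realConj π z g⁻¹ := by
    apply Subtype.ext
    simp [realConj, mul_assoc]
  simp only [h]
  rw [hψ z g⁻¹]

/-- A Real class function orthogonal to all irreducible characters vanishes; this carries the
spanning property. -/
theorem eq_zero_of_sum_mul_character [Finite Ghat] [Fintype π.ker] {ψ : π.ker → ℂ}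
    (hψ : ψ ∈ realClassFunctions π)
    (horth : ∀ W : ARep.{u, v} π, W.IsIrreducible → ∑ g, ψ g * W.character g = 0) : ψ = 0 := by
  have hψ' := conj_inv_mem_realClassFunctions hψ
  have horth' (W : ARep.{u, v} π) (hW : W.IsIrreducible) :
      ∑ g, starRingEnd ℂ (ψ g⁻¹) * W.character g = 0 := by
    have := hW.finiteDimensional
    rw [← map_zero (starRingEnd ℂ), ← horth W hW, map_sum]
    refine Fintype.sum_equiv (Equiv.inv π.ker) _ _ fun g => ?_
    simp [character_inv]
  -- Split `ψ` into its symmetric and antisymmetric parts under `ψ ↦ (g ↦ conj ψ(g⁻¹))`.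
  have h1 := eq_zero_of_sum_mul_character_of_symmetric (add_mem hψ hψ')
    (fun g => by simp [add_comm])
    fun W hW => by
      simp only [Pi.add_apply, add_mul, Finset.sum_add_distrib]
      rw [horth W hW, horth' W hW, add_zero]
  have h2 := eq_zero_of_sum_mul_character_of_symmetric
    (Submodule.smul_mem _ Complex.I (sub_mem hψ hψ'))
    (fun g => by simp; ring)
    fun W hW => by
      simp only [Pi.smul_apply, Pi.sub_apply, smul_eq_mul, mul_assoc, sub_mul, ← Finset.mul_sum,
        Finset.sum_sub_distrib]
      rw [horth W hW, horth' W hW, sub_zero, mul_zero]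
  rw [smul_eq_zero, or_iff_right Complex.I_ne_zero, sub_eq_zero] at h2
  rw [← h2] at h1
  ext g
  simpa using congrFun h1 g

/-! ### Counting -/

/-- The identification of Real class functions with functions on the set of Real conjugacy classes. -/
def realClassFunctionsEquiv : realClassFunctions π ≃ₗ[ℂ] (RealConjClasses π → ℂ) :=
  letI := realConjAction π
  { toFun := fun ψ => Quotient.lift ψ.1 (by
      intro a b hab
      obtain ⟨z, hz⟩ := MulAction.orbitRel_apply.mp hab
      rw [← hz]
      exact ψ.2 z b)
    invFun := fun F => ⟨fun g => F (Quotient.mk _ g), fun z g =>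
      congrArg F (Quotient.sound (s := MulAction.orbitRel Ghat π.ker)
        (MulAction.orbitRel_apply.mpr ⟨z, rfl⟩))⟩
    map_add' := fun ψ φ => by
      funext c
      induction c using Quotient.inductionOn
      rfl
    map_smul' := fun c ψ => by
      funext c
      induction c using Quotient.inductionOn
      rfl
    left_inv := fun ψ => rfl
    right_inv := fun F => by
      funext c
      induction c using Quotient.inductionOn
      rfl }

instance finite_realConjClasses [Finite Ghat] : Finite (RealConjClasses π) :=
  inferInstanceAs (Finite (@MulAction.orbitRel.Quotient Ghat π.ker _ (realConjAction π)))

theorem finrank_realClassFunctions [Finite Ghat] :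
    finrank ℂ (realClassFunctions π) = Nat.card (RealConjClasses π) := by
  have := Fintype.ofFinite (RealConjClasses π)
  rw [realClassFunctionsEquiv.finrank_eq, finrank_fintype_fun_eq_card, Nat.card_eq_fintype_card]

instance finite_irrClasses [Finite Ghat] : Finite (IrrClasses.{u, v} π) :=
  linearIndependent_classCharacter.finite_of_isNoetherian

/-- Pairing with the irreducible characters embeds the Real class functions into the functions on
the set of isomorphism classes. -/
theorem finrank_realClassFunctions_le_card [Finite Ghat] :
    finrank ℂ (realClassFunctions π) ≤ Nat.card (IrrClasses.{u, v} π) := by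
  have := Fintype.ofFinite π.ker
  have := Fintype.ofFinite (IrrClasses.{u, v} π)
  let L : realClassFunctions π →ₗ[ℂ] (IrrClasses.{u, v} π → ℂ) :=
    { toFun := fun ψ i => ∑ g, ψ.1 g * (classCharacter i).1 g
      map_add' := fun ψ φ => by
        ext i
        simp [add_mul, Finset.sum_add_distrib]
      map_smul' := fun c ψ => by
        ext i
        simp [Finset.mul_sum, mul_assoc] }
  have hL : Function.Injective L := by
    rw [← LinearMap.ker_eq_bot, LinearMap.ker_eq_bot']
    intro ψ hψ
    exact Subtype.ext (eq_zero_of_sum_mul_character ψ.2 fun W hW => congrFun hψ (irrClass W hW))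
  simpa [Nat.card_eq_fintype_card] using LinearMap.finrank_le_finrank_of_injective hL

theorem card_irrClasses_eq_finrank [Finite Ghat] :
    Nat.card (IrrClasses.{u, v} π) = finrank ℂ (realClassFunctions π) := by
  have := Fintype.ofFinite (IrrClasses.{u, v} π)
  refine le_antisymm ?_ finrank_realClassFunctions_le_card
  rw [Nat.card_eq_fintype_card]
  exact linearIndependent_classCharacter.fintype_card_le_finrank

end ARep
end

theorem mainTheorem7 {Ghat : Type u} [Group Ghat] [Finite Ghat]
    (π : Ghat →* ℤˣ) (hπ : Function.Surjective π) :
    Nat.card (ARep.IrrClasses.{u, v} π) = Nat.card (RealConjClasses π) ∧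
    ∃ b : Module.Basis (ARep.IrrClasses.{u, v} π) ℂ (realClassFunctions π),
      ∀ (W : ARep.{u, v} π) (hW : W.IsIrreducible),
        ((b (ARep.irrClass W hW) : realClassFunctions π) : π.ker → ℂ) = W.character := by
  have := Fintype.ofFinite (ARep.IrrClasses.{u, v} π)
  refine ⟨ARep.card_irrClasses_eq_finrank.trans ARep.finrank_realClassFunctions, ?_⟩
  refine ⟨Module.Basis.mk ARep.linearIndependent_classCharacter
    (ARep.linearIndependent_classCharacter.span_eq_top_of_card_eq_finrank' ?_).ge, fun W hW => ?_⟩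
  · rw [← Nat.card_eq_fintype_card, ARep.card_irrClasses_eq_finrank]
  · rw [Module.Basis.mk_apply, ARep.classCharacter_irrClass]
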